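/- **Proposition.** Let $\mathcal A,\mathcal B,\mathcal C$ be measurable spaces and let $\mathcal H_A,\mathcal H_B,\mathcal H_C$ be separable real reproducing kernel Hilbert spaces of functions on $\mathcal A,\mathcal B,\mathcal C$, with measurable kernels $k_A,k_B,k_C$ and canonical feature maps $\phi_A,\phi_B,\phi_C$, where $\phi_A(a)=k_A(\cdot,a)$ and likewise for $B,C$. Let $P$ be a probability measure on $\mathcal A\times\mathcal B\times\mathcal C$, the law of a triple $X=(A,B,C)$. Fix (deterministic) estimated conditional mean embeddings, i.e. measurable maps $\hat\mu_{A|C}:\mathcal C\to\mathcal H_A$ and $\hat\mu_{B|C}:\mathcal C\to\mathcal H_B$, and for $x=(a,b,c)$, $x'=(a',b',c')$ put $$\hat h(x,x') = k_C(c,c')\,\bigl\langle \phi_A(a)-\hat\mu_{A|C}(c),\,\phi_A(a')-\hat\mu_{A|C}(c')\bigr\rangle_{\mathcal H_A}\,\bigl\langle \phi_B(b)-\hat\mu_{B|C}(c),\,\phi_B(b')-\hat\mu_{B|C}(c')\bigr\rangle_{\mathcal H_B}.$$ For $X,X'$ independent with law $P$, assume $\mathbb E[\hat h(X,X')^2]<\infty$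 and set $\widehat{\mathrm{KCI}}=\mathbb E[\hat h(X,X')]$. For an i.i.d. sequence $X_1,X_2,\dots$ with law $P$ set $$\widehat{\mathrm{KCI}}_n=\frac1{n(n-1)}\sum_{1\le i\ne j\le n}\hat h(X_i,X_j).$$ Suppose that the alternative holds, i.e. $A$ and $B$ are not conditionally independent given $C$ (where conditional independence means $\mathbb E[f(A,C)g(B,C)\mid C]=\mathbb E[f(A,C)\mid C]\,\mathbb E[g(B,C)\mid C]$ almost surely for all square-integrable $f(A,C)$, $g(B,C)$). Then there is a scalar $\hat\sigma^2_{\mathfrak H_1}\ge 0$, depending only on $P$, the kernels and $\hat\mu_{A|C},\hat\mu_{B|C}$ (not on $n$ or on the sample), such that, as $n\to\infty$, $$\sqrt n\,\bigl(\widehat{\mathrm{KCI}}_n-\widehat{\mathrm{KCI}}\bigr)\xrightarrow{d}\mathcal N\bigl(0,\hat\sigma^2_{\mathfrak H_1}\bigr),$$ where $\mathcal N(0,0)$ denotes the point mass at $0$. -/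

import Mathlib

open MeasureTheory ProbabilityTheory Filter

noncomputable section

namespace KCI

/-- The canonical feature map `φ x = k(·, x)` of a real RKHS `H` of functions on `S`; it satisfies
the reproducing property `f x = ⟪f, φ x⟫`. -/
def featureMap {S : Type*} (H : Type*) [NormedAddCommGroup H] [InnerProductSpace ℝ H]
    [CompleteSpace H] [RKHS ℝ H S ℝ] (x : S) : H :=
  RKHS.kerFun H x (1 : ℝ)

/-- The reproducing kernel `k(x, y) = ⟪φ x, φ y⟫` of a real RKHS. -/
def kernelFn {S : Type*} (H : Type*) [NormedAddCommGroup H] [InnerProductSpace ℝ H]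
    [CompleteSpace H] [RKHS ℝ H S ℝ] (x y : S) : ℝ :=
  inner ℝ (featureMap H x) (featureMap H y)

/-- Conditional independence of `A` and `B` given `C` (Daudin): for all square-integrable
`f(A, C)` and `g(B, C)`,
`E[f(A, C) g(B, C) | C] = E[f(A, C) | C] E[g(B, C) | C]` almost surely. -/
def CondIndepGiven {Ω 𝒜 ℬ 𝒞 : Type*} [MeasurableSpace Ω] [MeasurableSpace 𝒜] [MeasurableSpace ℬ]
    [m𝒞 : MeasurableSpace 𝒞] (A : Ω → 𝒜) (B : Ω → ℬ) (C : Ω → 𝒞) (μ : Measure Ω) : Prop :=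
  ∀ (f : 𝒜 × 𝒞 → ℝ) (g : ℬ × 𝒞 → ℝ),
    MemLp f 2 (μ.map fun ω => (A ω, C ω)) → MemLp g 2 (μ.map fun ω => (B ω, C ω)) →
    μ[fun ω => f (A ω, C ω) * g (B ω, C ω) | m𝒞.comap C] =ᵐ[μ]
      fun ω => (μ[fun ω => f (A ω, C ω) | m𝒞.comap C]) ω *
        (μ[fun ω => g (B ω, C ω) | m𝒞.comap C]) ω

section Statistic

variable {𝒜 ℬ 𝒞 : Type*} {HA HB : Type*} (HC : Type*)
  [NormedAddCommGroup HA] [InnerProductSpace ℝ HA] [CompleteSpace HA] [RKHS ℝ HA 𝒜 ℝ]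
  [NormedAddCommGroup HB] [InnerProductSpace ℝ HB] [CompleteSpace HB] [RKHS ℝ HB ℬ ℝ]
  [NormedAddCommGroup HC] [InnerProductSpace ℝ HC] [CompleteSpace HC] [RKHS ℝ HC 𝒞 ℝ]

/-- The function `ĥ((a, b, c), (a', b', c'))` equal to
`k_C(c, c') ⟪φ_A a - μ̂_A c, φ_A a' - μ̂_A c'⟫ ⟪φ_B b - μ̂_B c, φ_B b' - μ̂_B c'⟫`. -/
def hHat (μA : 𝒞 → HA) (μB : 𝒞 → HB) (x x' : 𝒜 × ℬ × 𝒞) : ℝ :=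
  kernelFn HC x.2.2 x'.2.2 *
    inner ℝ (featureMap HA x.1 - μA x.2.2) (featureMap HA x'.1 - μA x'.2.2) *
    inner ℝ (featureMap HB x.2.1 - μB x.2.2) (featureMap HB x'.2.1 - μB x'.2.2)

/-- The U-statistic `(n (n - 1))⁻¹ ∑_{i ≠ j} ĥ(x_i, x_j)` of the first `n` points of `x`. -/
def kciHatStat (μA : 𝒞 → HA) (μB : 𝒞 → HB) (n : ℕ) (x : ℕ → 𝒜 × ℬ × 𝒞) : ℝ :=
  ((n : ℝ) * ((n : ℝ) - 1))⁻¹ *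
    ∑ p ∈ (Finset.range n).offDiag, hHat HC μA μB (x p.1) (x p.2)

/-- The population quantity `E ĥ(X, X')` with `X, X'` independent of law `P`. -/
def kciHat [MeasurableSpace 𝒜] [MeasurableSpace ℬ] [MeasurableSpace 𝒞]
    (μA : 𝒞 → HA) (μB : 𝒞 → HB) (P : Measure (𝒜 × ℬ × 𝒞)) : ℝ :=
  ∫ p, hHat HC μA μB p.1 p.2 ∂(P.prod P)

end Statistic

end KCI

end

open KCI

/-!
The statistic is a U-statistic of order two with the symmetric square-integrable kernel `ĥ`, so the
result is Hoeffding's central limit theorem for such statistics. Let `h` be the kernel, `θ` its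
mean and `g x = E h(x, X')`. Subtracting from `h(x, y)` its projection `g x + g y - θ` leaves a
kernel `r` whose sections have mean zero, and for `n ≥ 2` the U-statistic minus `θ` equals
`2 n⁻¹ ∑ i, (g (X i) - θ)` plus the U-statistic of `r`. By degeneracy, `r(X i, X j)` and
`r(X k, X l)` are uncorrelated unless `{i, j} = {k, l}`, so the second term has variance of order
`n⁻²` and vanishes at scale `√n`; the first obeys the classical central limit theorem. The limiting
variance is therefore `4 Var g(X)`, which may be zero.
-/

namespace KCI

section Probability

variable {Ω S : Type*} [MeasurableSpace Ω] [MeasurableSpace S] {P : Measure S} {ν : Measure Ω}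

lemma memLp_comp_of_hasLaw {E : Type*} [NormedAddCommGroup E] {X : Ω → S} {f : S → E}
    {p : ENNReal} (hX : HasLaw X P ν) (hf : MemLp f p P) : MemLp (fun ω => f (X ω)) p ν := by
  rw [← hX.map_eq] at hf
  exact hf.comp_of_map hX.aemeasurable

lemma tendstoInMeasure_zero_of_tendsto_integral_sq {ι : Type*} {l : Filter ι} {f : ι → Ω → ℝ}
    (hf : ∀ i, MemLp (f i) 2 ν) (h : Tendsto (fun i => ∫ ω, f i ω ^ 2 ∂ν) l (nhds 0)) :
    TendstoInMeasure ν f l 0 := by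
  refine tendstoInMeasure_of_tendsto_eLpNorm two_ne_zero (fun i => (hf i).1)
    aestronglyMeasurable_const ?_
  have hnorm (i : ι) : eLpNorm (f i - 0) 2 ν = ENNReal.ofReal √(∫ ω, f i ω ^ 2 ∂ν) := by
    rw [sub_zero, (hf i).eLpNorm_eq_integral_rpow_norm two_ne_zero ENNReal.ofNat_ne_top,
      Real.sqrt_eq_rpow]
    simp
  simp_rw [hnorm]
  simpa using ENNReal.tendsto_ofReal h.sqrt

theorem tendstoInDistribution_inv_sqrt_mul_sum_comp [IsProbabilityMeasure ν] {X : ℕ → Ω → S}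
    (hX : ∀ i, HasLaw (X i) P ν) (hind : iIndepFun X ν) {g : S → ℝ} (hg : MemLp g 2 P) :
    TendstoInDistribution
      (fun (n : ℕ) ω => (√(n : ℝ))⁻¹ * (∑ i ∈ Finset.range n, g (X i ω) - n * ∫ x, g x ∂P))
      atTop (id : ℝ → ℝ) (fun _ => ν) (gaussianReal 0 Var[g; P].toNNReal) := by
  have hglaw : HasLaw g (P.map g) P := ⟨hg.1.aemeasurable, rfl⟩
  have hident (i : ℕ) : IdentDistrib (fun ω => g (X i ω)) g ν P :=
    (hglaw.fun_comp (hX i)).identDistrib hglaw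
  have hindep : iIndepFun (fun i ω => g (X i ω)) ν :=
    hind.comp₀ (fun _ => g) (fun i => (hX i).aemeasurable) fun i => by
      rw [(hX i).map_eq]
      exact hg.1.aemeasurable
  have hclt := tendstoInDistribution_inv_sqrt_mul_sum_sub
    (Y := (id : ℝ → ℝ)) (P' := gaussianReal 0 Var[g; P].toNNReal)
    (X := fun i ω => g (X i ω)) (by rw [(hident 0).variance_eq]; exact HasLaw.id)
    (memLp_comp_of_hasLaw (hX 0) hg) hindep fun i => (hident i).trans (hident 0).symm
  rwa [(hident 0).integral_eq] at hclt

end Probability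

section OffDiagonal

variable {ι R : Type*} [CommRing R]

lemma cast_card_offDiag (s : Finset ι) : (s.offDiag.card : R) = s.card * (s.card - 1) := by
  rw [Finset.offDiag_card, Nat.cast_sub (Nat.le_mul_self _)]
  push_cast
  ring

lemma sum_offDiag_fst_add_snd (s : Finset ι) (a : ι → R) :
    ∑ p ∈ s.offDiag, (a p.1 + a p.2) = 2 * (s.card - 1) * ∑ i ∈ s, a i := by
  classical
  have h := Finset.sum_product s s fun p : ι × ι => a p.1 + a p.2
  rw [← Finset.diag_union_offDiag, Finset.sum_union (Finset.disjoint_diag_offDiag _),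
    Finset.sum_diag] at h
  simp only [Finset.sum_add_distrib, Finset.sum_const, nsmul_eq_mul, ← Finset.mul_sum] at h
  rw [Finset.sum_add_distrib]
  linear_combination h

end OffDiagonal

section HoeffdingDecomposition

variable {S : Type*} [MeasurableSpace S] {P : Measure S}

/-- The first-order (Hájek) projection `x ↦ E h(x, X')` of a kernel `h`, where `X'` has law `P`. -/
noncomputable def hajekProj (P : Measure S) (h : S → S → ℝ) (x : S) : ℝ := ∫ y, h x y ∂P

/-- The second-order part of the Hoeffding decomposition of a kernel `h`. Both variables are
projected by `hajekProj`, so this is the usual notion only for symmetric `h`. -/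
noncomputable def degeneratePart (P : Measure S) (h : S → S → ℝ) (x y : S) : ℝ :=
  h x y - hajekProj P h x - hajekProj P h y + ∫ p, h p.1 p.2 ∂(P.prod P)

/-- A kernel is degenerate if its average over the first variable vanishes for almost every value
of the second. For a symmetric kernel this is complete degeneracy in Hoeffding's sense. -/
def IsDegenerate (P : Measure S) (r : S → S → ℝ) : Prop := ∀ᵐ y ∂P, ∫ x, r x y ∂P = 0

lemma degeneratePart_comm {h : S → S → ℝ} (hsymm : ∀ x y, h x y = h y x) (x y : S) :
    degeneratePart P h x y = degeneratePart P h y x := by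
  simp only [degeneratePart, hsymm x y]
  ring

variable [IsProbabilityMeasure P] {h : S → S → ℝ}

lemma memLp_hajekProj (hh : MemLp (fun p : S × S => h p.1 p.2) 2 (P.prod P)) :
    MemLp (hajekProj P h) 2 P := by
  have hmeas : AEStronglyMeasurable (hajekProj P h) P := hh.1.integral_prod_right'
  have hsq : Integrable (fun p : S × S => h p.1 p.2 ^ 2) (P.prod P) := hh.integrable_sq
  refine (memLp_two_iff_integrable_sq hmeas).2 (hsq.integral_prod_left.mono' (hmeas.pow 2) ?_)
  filter_upwards [hsq.prod_right_ae, hh.1.prodMk_left] with x hx hxmeas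
  have hvar : 0 ≤ ∫ y, h x y ^ 2 ∂P - hajekProj P h x ^ 2 := by
    have := variance_nonneg (h x) P
    rwa [variance_eq_sub ((memLp_two_iff_integrable_sq hxmeas).2 hx)] at this
  rw [Real.norm_of_nonneg (sq_nonneg _)]
  exact sub_nonneg.1 hvar

lemma integral_hajekProj (hh : MemLp (fun p : S × S => h p.1 p.2) 2 (P.prod P)) :
    ∫ x, hajekProj P h x ∂P = ∫ p, h p.1 p.2 ∂(P.prod P) :=
  (integral_prod _ (hh.integrable one_le_two)).symm

lemma memLp_degeneratePart (hh : MemLp (fun p : S × S => h p.1 p.2) 2 (P.prod P)) :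
    MemLp (fun p : S × S => degeneratePart P h p.1 p.2) 2 (P.prod P) := by
  have hproj := memLp_hajekProj hh
  exact ((hh.sub (hproj.comp_measurePreserving measurePreserving_fst)).sub
    (hproj.comp_measurePreserving measurePreserving_snd)).add (memLp_const _)

lemma isDegenerate_degeneratePart (hsymm : ∀ x y, h x y = h y x)
    (hh : MemLp (fun p : S × S => h p.1 p.2) 2 (P.prod P)) :
    IsDegenerate P (degeneratePart P h) := by
  have hproj : Integrable (hajekProj P h) P := (memLp_hajekProj hh).integrable one_le_two
  filter_upwards [(hh.integrable one_le_two).prod_right_ae] with y hy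
  have hdiff : Integrable (fun x => h y x - hajekProj P h x) P := hy.sub hproj
  have hcentered : Integrable (fun x => h y x - hajekProj P h x - hajekProj P h y) P :=
    hdiff.sub (integrable_const _)
  simp only [degeneratePart, fun x => hsymm x y]
  rw [integral_add hcentered (integrable_const _), integral_sub hdiff (integrable_const _),
    integral_sub hy hproj, integral_hajekProj hh]
  simp [hajekProj]

end HoeffdingDecomposition

section DegenerateKernel

variable {Ω S ι : Type*} [MeasurableSpace Ω] [MeasurableSpace S] {P : Measure S} {ν : Measure Ω}
  {X : ι → Ω → S} {r : S → S → ℝ}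

lemma indepFun_prodMk_prodMk_of_ne (hX : ∀ i, AEMeasurable (X i) ν) (hind : iIndepFun X ν)
    {i j k l : ι} (hij : i ≠ j) (hik : i ≠ k) (hil : i ≠ l) :
    IndepFun (X i) (fun ω => (X j ω, X k ω, X l ω)) ν := by
  classical
  have htuple := hind.indepFun_finset₀ {i} {j, k, l} (by simp [hij, hik, hil]) hX
  exact htuple.comp (φ := fun u : ({i} : Finset ι) → S => u ⟨i, by simp⟩)
    (ψ := fun z : ({j, k, l} : Finset ι) → S =>
      (z ⟨j, by simp⟩, z ⟨k, by simp⟩, z ⟨l, by simp⟩)) (by fun_prop) (by fun_prop)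

variable [IsProbabilityMeasure ν]

lemma hasLaw_prodMk_of_ne (hX : ∀ i, HasLaw (X i) P ν) (hind : iIndepFun X ν) {i j : ι}
    (hij : i ≠ j) : HasLaw (fun ω => (X i ω, X j ω)) (P.prod P) ν :=
  (hind.indepFun hij).hasLaw_prod (hX i) (hX j)

lemma memLp_kernel_comp (hX : ∀ i, HasLaw (X i) P ν) (hind : iIndepFun X ν)
    (hr : MemLp (fun p : S × S => r p.1 p.2) 2 (P.prod P)) {i j : ι} (hij : i ≠ j) :
    MemLp (fun ω => r (X i ω) (X j ω)) 2 ν :=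
  memLp_comp_of_hasLaw (hasLaw_prodMk_of_ne hX hind hij) hr

variable [IsProbabilityMeasure P]

lemma IsDegenerate.integral_mul_comp_eq_zero {T : Type*} [MeasurableSpace T] {Q : Measure T}
    [IsProbabilityMeasure Q] (hdeg : IsDegenerate P r)
    (hr : MemLp (fun p : S × S => r p.1 p.2) 2 (P.prod P)) {s : T → ℝ} (hs : MemLp s 2 Q)
    {Y V : Ω → S} {W : Ω → T} (hY : HasLaw Y P ν) (hV : HasLaw V P ν) (hW : HasLaw W Q ν)
    (hind : IndepFun Y (fun ω => (V ω, W ω)) ν) :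
    ∫ ω, r (Y ω) (V ω) * s (W ω) ∂ν = 0 := by
  have hVW : HasLaw (fun ω => (V ω, W ω)) (ν.map fun ω => (V ω, W ω)) ν :=
    ⟨hV.aemeasurable.prodMk hW.aemeasurable, rfl⟩
  set ρ := ν.map fun ω => (V ω, W ω)
  have : IsProbabilityMeasure ρ := hVW.isProbabilityMeasure_iff.1 ‹_›
  have hfst : MeasurePreserving Prod.fst ρ P :=
    ⟨measurable_fst, by
      rw [AEMeasurable.map_map_of_aemeasurable (by fun_prop) hVW.aemeasurable]
      exact hV.map_eq⟩
  have hsnd : MeasurePreserving Prod.snd ρ Q :=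
    ⟨measurable_snd, by
      rw [AEMeasurable.map_map_of_aemeasurable (by fun_prop) hVW.aemeasurable]
      exact hW.map_eq⟩
  have hint : Integrable (fun p : S × S × T => r p.1 p.2.1 * s p.2.2) (P.prod ρ) :=
    (hr.comp_measurePreserving ((MeasurePreserving.id P).prod hfst)).integrable_mul
      (hs.comp_measurePreserving (hsnd.comp measurePreserving_snd))
  calc ∫ ω, r (Y ω) (V ω) * s (W ω) ∂ν
      = ∫ p : S × S × T, r p.1 p.2.1 * s p.2.2 ∂(P.prod ρ) :=
        (hind.hasLaw_prod hY hVW).integral_comp hint.1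
    _ = ∫ z, (∫ x, r x z.1 ∂P) * s z.2 ∂ρ := by
        rw [integral_prod_symm _ hint]
        simp_rw [integral_mul_const]
    _ = 0 := by
        refine integral_eq_zero_of_ae ?_
        filter_upwards [hfst.quasiMeasurePreserving.ae hdeg] with z hz
        simp [hz]

lemma IsDegenerate.integral_mul_eq_zero (hdeg : IsDegenerate P r)
    (hr : MemLp (fun p : S × S => r p.1 p.2) 2 (P.prod P)) (hsymm : ∀ x y, r x y = r y x)
    (hX : ∀ i, HasLaw (X i) P ν) (hind : iIndepFun X ν) {i j k l : ι} (hij : i ≠ j) (hkl : k ≠ l)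
    (hne : (k, l) ≠ (i, j)) (hne_swap : (k, l) ≠ (j, i)) :
    ∫ ω, r (X i ω) (X j ω) * r (X k ω) (X l ω) ∂ν = 0 := by
  have key {i j : ι} (hij : i ≠ j) (hik : i ≠ k) (hil : i ≠ l) :
      ∫ ω, r (X i ω) (X j ω) * r (X k ω) (X l ω) ∂ν = 0 :=
    hdeg.integral_mul_comp_eq_zero hr hr (hX i) (hX j) (hasLaw_prodMk_of_ne hX hind hkl)
      (indepFun_prodMk_prodMk_of_ne (fun i => (hX i).aemeasurable) hind hij hik hil)
  have hfresh : (i ≠ k ∧ i ≠ l) ∨ (j ≠ k ∧ j ≠ l) := by grind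
  rcases hfresh with ⟨hik, hil⟩ | ⟨hjk, hjl⟩
  · exact key hij hik hil
  · simp_rw [fun ω => hsymm (X i ω) (X j ω)]
    exact key hij.symm hjk hjl

lemma IsDegenerate.sum_offDiag_integral_mul (hdeg : IsDegenerate P r)
    (hr : MemLp (fun p : S × S => r p.1 p.2) 2 (P.prod P)) (hsymm : ∀ x y, r x y = r y x)
    (hX : ∀ i, HasLaw (X i) P ν) (hind : iIndepFun X ν) {s : Finset ι} {p : ι × ι}
    (hp : p ∈ s.offDiag) :
    ∑ q ∈ s.offDiag, ∫ ω, r (X p.1 ω) (X p.2 ω) * r (X q.1 ω) (X q.2 ω) ∂ν =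
      2 * ∫ z, r z.1 z.2 ^ 2 ∂(P.prod P) := by
  classical
  obtain ⟨hp₁, hp₂, hpne⟩ := Finset.mem_offDiag.1 hp
  have hsub : {p, p.swap} ⊆ s.offDiag := by
    simp [Finset.insert_subset_iff, hp₁, hp₂, hpne, hpne.symm]
  have hsq : ∫ ω, r (X p.1 ω) (X p.2 ω) * r (X p.1 ω) (X p.2 ω) ∂ν =
      ∫ z, r z.1 z.2 ^ 2 ∂(P.prod P) := by
    simp_rw [← pow_two]
    exact (hasLaw_prodMk_of_ne hX hind hpne).integral_comp hr.integrable_sq.1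
  have hswap : ∫ ω, r (X p.1 ω) (X p.2 ω) * r (X p.swap.1 ω) (X p.swap.2 ω) ∂ν =
      ∫ z, r z.1 z.2 ^ 2 ∂(P.prod P) := by
    simpa only [Prod.fst_swap, Prod.snd_swap, fun ω => hsymm (X p.2 ω) (X p.1 ω)] using hsq
  rw [← Finset.sum_subset hsub fun q hq hqp => ?_, Finset.sum_pair ?_, hsq, hswap, two_mul]
  · exact fun h => hpne (congrArg Prod.fst h)
  · simp only [Finset.mem_insert, Finset.mem_singleton, not_or] at hqp
    exact hdeg.integral_mul_eq_zero hr hsymm hX hind hpne (Finset.mem_offDiag.1 hq).2.2 hqp.1 hqp.2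

lemma IsDegenerate.integral_sq_sum_offDiag (hdeg : IsDegenerate P r)
    (hr : MemLp (fun p : S × S => r p.1 p.2) 2 (P.prod P)) (hsymm : ∀ x y, r x y = r y x)
    (hX : ∀ i, HasLaw (X i) P ν) (hind : iIndepFun X ν) (s : Finset ι) :
    ∫ ω, (∑ p ∈ s.offDiag, r (X p.1 ω) (X p.2 ω)) ^ 2 ∂ν =
      s.offDiag.card * (2 * ∫ z, r z.1 z.2 ^ 2 ∂(P.prod P)) := by
  have hint : ∀ p ∈ s.offDiag, ∀ q ∈ s.offDiag,
      Integrable (fun ω => r (X p.1 ω) (X p.2 ω) * r (X q.1 ω) (X q.2 ω)) ν := fun p hp q hq =>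
    (memLp_kernel_comp hX hind hr (Finset.mem_offDiag.1 hp).2.2).integrable_mul
      (memLp_kernel_comp hX hind hr (Finset.mem_offDiag.1 hq).2.2)
  calc ∫ ω, (∑ p ∈ s.offDiag, r (X p.1 ω) (X p.2 ω)) ^ 2 ∂ν
      = ∑ p ∈ s.offDiag, ∑ q ∈ s.offDiag,
          ∫ ω, r (X p.1 ω) (X p.2 ω) * r (X q.1 ω) (X q.2 ω) ∂ν := by
        simp_rw [pow_two, Finset.sum_mul_sum]
        rw [integral_finsetSum _ fun p hp => integrable_finsetSum _ (hint p hp)]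
        exact Finset.sum_congr rfl fun p hp => integral_finsetSum _ (hint p hp)
    _ = ∑ p ∈ s.offDiag, 2 * ∫ z, r z.1 z.2 ^ 2 ∂(P.prod P) :=
        Finset.sum_congr rfl fun p hp => hdeg.sum_offDiag_integral_mul hr hsymm hX hind hp
    _ = s.offDiag.card * (2 * ∫ z, r z.1 z.2 ^ 2 ∂(P.prod P)) := by
        rw [Finset.sum_const, nsmul_eq_mul]

end DegenerateKernel

section UStatistic

variable {Ω S : Type*} [MeasurableSpace Ω] [MeasurableSpace S] {P : Measure S} {ν : Measure Ω}
  {X : ℕ → Ω → S}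

/-- The U-statistic of order two with kernel `h`, evaluated at the first `n` points of `x`. It is
zero for `n ≤ 1`. -/
noncomputable def uStat {S : Type*} (h : S → S → ℝ) (n : ℕ) (x : ℕ → S) : ℝ :=
  ((n : ℝ) * ((n : ℝ) - 1))⁻¹ * ∑ p ∈ (Finset.range n).offDiag, h (x p.1) (x p.2)

lemma uStat_sub_integral (P : Measure S) (h : S → S → ℝ) (x : ℕ → S) {n : ℕ} (hn : 2 ≤ n) :
    uStat h n x - ∫ p, h p.1 p.2 ∂(P.prod P) =
      2 * (n : ℝ)⁻¹ * ∑ i ∈ Finset.range n, (hajekProj P h (x i) - ∫ p, h p.1 p.2 ∂(P.prod P)) +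
        uStat (degeneratePart P h) n x := by
  set θ := ∫ p, h p.1 p.2 ∂(P.prod P) with hθ
  have hn₀ : (n : ℝ) ≠ 0 := by positivity
  have hn₁ : (n : ℝ) - 1 ≠ 0 := by
    have : (2 : ℝ) ≤ n := by exact_mod_cast hn
    linarith
  have hproj := sum_offDiag_fst_add_snd (Finset.range n) fun i => hajekProj P h (x i)
  have hcard := cast_card_offDiag (R := ℝ) (Finset.range n)
  rw [Finset.card_range] at hproj hcard
  have hdeg : ∑ p ∈ (Finset.range n).offDiag, degeneratePart P h (x p.1) (x p.2) =
      ∑ p ∈ (Finset.range n).offDiag, h (x p.1) (x p.2) -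
        2 * (n - 1) * ∑ i ∈ Finset.range n, hajekProj P h (x i) + n * (n - 1) * θ := by
    rw [← hproj, ← hcard, ← nsmul_eq_mul, ← Finset.sum_const, ← Finset.sum_sub_distrib,
      ← Finset.sum_add_distrib]
    refine Finset.sum_congr rfl fun p _ => ?_
    rw [degeneratePart, ← hθ]
    ring
  rw [uStat, uStat, hdeg, Finset.sum_sub_distrib, Finset.sum_const, Finset.card_range,
    nsmul_eq_mul]
  field_simp
  ring

lemma memLp_uStat [IsProbabilityMeasure ν] {h : S → S → ℝ}
    (hh : MemLp (fun p : S × S => h p.1 p.2) 2 (P.prod P)) (hX : ∀ i, HasLaw (X i) P ν)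
    (hind : iIndepFun X ν) (n : ℕ) : MemLp (fun ω => uStat h n fun i => X i ω) 2 ν :=
  (memLp_finsetSum _ fun _ hp =>
    memLp_kernel_comp hX hind hh (Finset.mem_offDiag.1 hp).2.2).const_mul _

variable [IsProbabilityMeasure P] [IsProbabilityMeasure ν]

lemma IsDegenerate.integral_sq_uStat {r : S → S → ℝ} (hdeg : IsDegenerate P r)
    (hr : MemLp (fun p : S × S => r p.1 p.2) 2 (P.prod P)) (hsymm : ∀ x y, r x y = r y x)
    (hX : ∀ i, HasLaw (X i) P ν) (hind : iIndepFun X ν) (n : ℕ) :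
    ∫ ω, uStat r n (fun i => X i ω) ^ 2 ∂ν =
      ((n : ℝ) * (n - 1))⁻¹ * (2 * ∫ z, r z.1 z.2 ^ 2 ∂(P.prod P)) := by
  have hinv := mul_self_mul_inv ((n : ℝ) * (n - 1))⁻¹
  rw [inv_inv] at hinv
  simp_rw [uStat, mul_pow]
  rw [integral_const_mul, hdeg.integral_sq_sum_offDiag hr hsymm hX hind, cast_card_offDiag,
    Finset.card_range, ← mul_assoc, pow_two, hinv]

lemma IsDegenerate.tendstoInMeasure_sqrt_mul_uStat {r : S → S → ℝ} (hdeg : IsDegenerate P r)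
    (hr : MemLp (fun p : S × S => r p.1 p.2) 2 (P.prod P)) (hsymm : ∀ x y, r x y = r y x)
    (hX : ∀ i, HasLaw (X i) P ν) (hind : iIndepFun X ν) :
    TendstoInMeasure ν (fun (n : ℕ) ω => √(n : ℝ) * uStat r n fun i => X i ω) atTop 0 := by
  refine tendstoInMeasure_zero_of_tendsto_integral_sq
    (fun n => (memLp_uStat hr hX hind n).const_mul _) ?_
  set M := ∫ z, r z.1 z.2 ^ 2 ∂(P.prod P)
  have hmoment : ∀ᶠ n : ℕ in atTop,
      ((n : ℝ) - 1)⁻¹ * (2 * M) = ∫ ω, (√(n : ℝ) * uStat r n fun i => X i ω) ^ 2 ∂ν := by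
    filter_upwards [eventually_ne_atTop 0] with n hn
    have hn₀ : (n : ℝ) ≠ 0 := Nat.cast_ne_zero.2 hn
    simp_rw [mul_pow, Real.sq_sqrt (Nat.cast_nonneg n)]
    rw [integral_const_mul, hdeg.integral_sq_uStat hr hsymm hX hind, mul_inv, mul_assoc,
      mul_inv_cancel_left₀ hn₀]
  have hdecay : Tendsto (fun n : ℕ => ((n : ℝ) - 1)⁻¹) atTop (nhds 0) :=
    tendsto_inv_atTop_zero.comp
      (tendsto_atTop_add_const_right _ (-1) tendsto_natCast_atTop_atTop)
  simpa using (hdecay.mul_const (2 * M)).congr' hmoment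

theorem tendstoInDistribution_sqrt_mul_uStat_sub {h : S → S → ℝ} (hsymm : ∀ x y, h x y = h y x)
    (hh : MemLp (fun p : S × S => h p.1 p.2) 2 (P.prod P)) (hX : ∀ i, HasLaw (X i) P ν)
    (hind : iIndepFun X ν) :
    TendstoInDistribution
      (fun (n : ℕ) ω => √(n : ℝ) *
        (uStat h n (fun i => X i ω) - ∫ p, h p.1 p.2 ∂(P.prod P)))
      atTop (id : ℝ → ℝ) (fun _ => ν)
      (gaussianReal 0 (4 * Var[hajekProj P h; P]).toNNReal) := by
  have hclt := tendstoInDistribution_inv_sqrt_mul_sum_comp hX hind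
    ((memLp_hajekProj hh).const_mul 2)
  have hvar : Var[fun x => 2 * hajekProj P h x; P] = 4 * Var[hajekProj P h; P] := by
    rw [variance_const_mul]
    norm_num
  rw [hvar, integral_const_mul, integral_hajekProj hh] at hclt
  refine tendstoInDistribution_of_tendstoInMeasure_sub _ _ hclt ?_ fun n =>
    ((memLp_uStat hh hX hind n).1.aemeasurable.sub_const _).const_mul _
  have hrem := (isDegenerate_degeneratePart hsymm hh).tendstoInMeasure_sqrt_mul_uStat
    (memLp_degeneratePart hh) (degeneratePart_comm hsymm) hX hind
  refine hrem.congr' ?_ .rfl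
  filter_upwards [eventually_ge_atTop 2] with n hn
  refine .of_forall fun ω => ?_
  have hn₀ : (n : ℝ) ≠ 0 := by positivity
  simp only [Pi.sub_apply]
  rw [uStat_sub_integral P h _ hn, ← Real.sqrt_div_self, Finset.sum_sub_distrib,
    Finset.sum_const, Finset.card_range, nsmul_eq_mul, ← Finset.mul_sum]
  field_simp
  ring

end UStatistic

section KernelStatistic

variable {𝒜 ℬ 𝒞 HA HB HC : Type*}
  [NormedAddCommGroup HA] [InnerProductSpace ℝ HA] [CompleteSpace HA] [RKHS ℝ HA 𝒜 ℝ]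
  [NormedAddCommGroup HB] [InnerProductSpace ℝ HB] [CompleteSpace HB] [RKHS ℝ HB ℬ ℝ]
  [NormedAddCommGroup HC] [InnerProductSpace ℝ HC] [CompleteSpace HC] [RKHS ℝ HC 𝒞 ℝ]
  {μA : 𝒞 → HA} {μB : 𝒞 → HB}

variable (HC μA μB) in
lemma hHat_comm (x x' : 𝒜 × ℬ × 𝒞) : hHat HC μA μB x x' = hHat HC μA μB x' x := by
  simp only [hHat, kernelFn]
  rw [real_inner_comm, real_inner_comm (featureMap HA x'.1 - _),
    real_inner_comm (featureMap HB x'.2.1 - _)]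

theorem mainTheorem7_general [MeasurableSpace 𝒜] [MeasurableSpace ℬ] [MeasurableSpace 𝒞]
    {P : Measure (𝒜 × ℬ × 𝒞)} [IsProbabilityMeasure P]
    (hmom : MemLp (fun p : (𝒜 × ℬ × 𝒞) × (𝒜 × ℬ × 𝒞) => hHat HC μA μB p.1 p.2) 2 (P.prod P))
    {Ω : Type*} [MeasurableSpace Ω] {ν : Measure Ω} [IsProbabilityMeasure ν]
    {X : ℕ → Ω → 𝒜 × ℬ × 𝒞} (hX : ∀ i, HasLaw (X i) P ν) (hind : iIndepFun X ν) :
    TendstoInDistribution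
      (fun (n : ℕ) ω => √(n : ℝ) *
        (kciHatStat HC μA μB n (fun i => X i ω) - kciHat HC μA μB P))
      atTop (id : ℝ → ℝ) (fun _ => ν)
      (gaussianReal 0 (4 * Var[hajekProj P (hHat HC μA μB); P]).toNNReal) :=
  tendstoInDistribution_sqrt_mul_uStat_sub (hHat_comm HC μA μB) hmom hX hind

end KernelStatistic

end KCI

theorem mainTheorem7 {𝒜 ℬ 𝒞 HA HB HC : Type*}
    [MeasurableSpace 𝒜] [MeasurableSpace ℬ] [MeasurableSpace 𝒞]
    [NormedAddCommGroup HA] [InnerProductSpace ℝ HA] [CompleteSpace HA]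
    [TopologicalSpace.SeparableSpace HA] [RKHS ℝ HA 𝒜 ℝ]
    [NormedAddCommGroup HB] [InnerProductSpace ℝ HB] [CompleteSpace HB]
    [TopologicalSpace.SeparableSpace HB] [RKHS ℝ HB ℬ ℝ]
    [NormedAddCommGroup HC] [InnerProductSpace ℝ HC] [CompleteSpace HC]
    [TopologicalSpace.SeparableSpace HC] [RKHS ℝ HC 𝒞 ℝ]
    (hkA : Measurable fun p : 𝒜 × 𝒜 => kernelFn HA p.1 p.2)
    (hkB : Measurable fun p : ℬ × ℬ => kernelFn HB p.1 p.2)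
    (hkC : Measurable fun p : 𝒞 × 𝒞 => kernelFn HC p.1 p.2)
    (μA : 𝒞 → HA) (hμA : StronglyMeasurable μA)
    (μB : 𝒞 → HB) (hμB : StronglyMeasurable μB)
    (P : Measure (𝒜 × ℬ × 𝒞)) [IsProbabilityMeasure P]
    (hmom : MemLp (fun p : (𝒜 × ℬ × 𝒞) × (𝒜 × ℬ × 𝒞) => hHat HC μA μB p.1 p.2) 2 (P.prod P))
    (halt : ¬ CondIndepGiven (fun x : 𝒜 × ℬ × 𝒞 => x.1) (fun x => x.2.1) (fun x => x.2.2) P) :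
    ∃ σsq : NNReal, ∀ (Ω : Type*) [MeasurableSpace Ω] (ν : Measure Ω) [IsProbabilityMeasure ν]
      (X : ℕ → Ω → 𝒜 × ℬ × 𝒞), (∀ i, HasLaw (X i) P ν) → iIndepFun X ν →
      TendstoInDistribution
        (fun (n : ℕ) ω => √(n : ℝ) *
          (kciHatStat HC μA μB n (fun i => X i ω) - kciHat HC μA μB P))
        atTop (id : ℝ → ℝ) (fun _ => ν) (gaussianReal 0 σsq) :=
  ⟨_, fun _ _ _ _ _ hX hind => mainTheorem7_general hmom hX hind⟩
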